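/- For $n\ge 1$ let ${\sf GOE}(n)$ denote the law of the random symmetric matrix $W=(G+G^{\sf T})/\sqrt{2n}$, where $G\in\mathbb{R}^{n\times n}$ has i.i.d. standard Gaussian entries. For $\beta>0$, $\lambda\in\mathbb{R}$, $x_0\in\{+1,-1\}^n$ and $W\in\mathbb{R}^{n\times n}$ let $$Z_n(\beta)=\sum_{\sigma\in\{+1,-1\}^n}\exp\Big\{\frac{\beta\lambda}{2n}\langle x_0,\sigma\rangle^2+\frac{\beta}{2}\langle W,\sigma\sigma^{\sf T}\rangle\Big\},\qquad \langle W,\sigma\sigma^{\sf T}\rangle=\sum_{i,j=1}^n W_{ij}\sigma_i\sigma_j .$$ **Theorem (Thermodynamic limit).** Let $\lambda=0$ (the Sherrington–Kirkpatrick model). For every $\beta>0$ there is a deterministic constant $\phi=\phi(\beta)\in\mathbb{R}$ such that, whenever $(W_n)_{n\ge1}$ are random matrices on a common probability space with $W_n\sim{\sf GOE}(n)$ for every $n$ (with an arbitrary joint law), the partition functions $Z_n(\beta)$ of $W=W_n$ satisfy $$\lim_{n\to\infty}\frac1n\log Z_n(\beta)=\phi\qquad\text{almost surely.}$$ -/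

import Mathlib

open MeasureTheory ProbabilityTheory Filter Topology

noncomputable section

/-- The product (equivalently, Borel) σ-algebra on real matrices. -/
instance instMeasurableSpaceRealMatrix (m n : Type*) : MeasurableSpace (Matrix m n ℝ) :=
  inferInstanceAs (MeasurableSpace (m → n → ℝ))

/-- The law of an `n × n` matrix `G` with i.i.d. standard Gaussian entries. -/
def gaussianMatrix (n : ℕ) : Measure (Matrix (Fin n) (Fin n) ℝ) :=
  Measure.pi fun _ : Fin n => Measure.pi fun _ : Fin n => gaussianReal 0 1

/-- `GOE(n)`: the law of `W = (G + Gᵀ) / √(2n)`, where `G` has i.i.d. standard Gaussian entries. -/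
def GOE (n : ℕ) : Measure (Matrix (Fin n) (Fin n) ℝ) :=
  (gaussianMatrix n).map fun G => (√(2 * n))⁻¹ • (G + G.transpose)

/-- A spin configuration `σ ∈ {+1, -1}ⁿ`. -/
abbrev SpinConfig (n : ℕ) := Fin n → ℤˣ

/-- The vector in `ℝⁿ` of a spin configuration. -/
def SpinConfig.toReal {n : ℕ} (σ : SpinConfig n) (i : Fin n) : ℝ := ((σ i : ℤ) : ℝ)

/-- The partition function
`Z_n = ∑_{σ ∈ {±1}ⁿ} exp ((β λ / 2n) ⟨x₀, σ⟩² + (β / 2) ⟨W, σ σᵀ⟩)`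
of the spiked Sherrington-Kirkpatrick model; `lam` is the signal strength `λ` and `x₀` the signal. -/
def partitionFunction {n : ℕ} (β lam : ℝ) (x₀ : SpinConfig n) (W : Matrix (Fin n) (Fin n) ℝ) : ℝ :=
  ∑ σ : SpinConfig n,
    Real.exp (β * lam / (2 * n) * (∑ i, x₀.toReal i * σ.toReal i) ^ 2
      + β / 2 * ∑ i, ∑ j, W i j * (σ.toReal i * σ.toReal j))

end

/-! Write F_n for the mean of log Z_n at λ = 0. It suffices that F_n / n converges and that log Z_n
stays within o(n) of F_n outside events of summable probability.

The first is the Guerra–Toninelli argument. The Hamiltonian is a Gaussian process on the cube with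
covariance (β²/2) n R², where R is the overlap of two configurations. Splitting n + m spins into two
blocks with independent couplings keeps the variances and, by convexity of the square, does not
lower the covariances. Gaussian comparison (`integral_logSumExp_le_of_covariance_le`), proved by
interpolation and integration by parts, then shows that decoupling cannot raise the mean free
energy. So F is superadditive (`skMeanFreeEnergy_add_le`), and Fekete's lemma with the annealed
bound gives the limit φ.

For the second, log Z_n is Lipschitz with constant β/√(2n) in each of the n² independent entries of
G, so it deviates from F_n by tn with probability at most 2 exp(-n t²/(2β²))
(`GOE_abs_log_partitionFunction_sub_ge_le`). Borel–Cantelli uses only the marginal laws, which is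
why the joint law may be arbitrary. -/

/-- The standard Gaussian measure on `ι → ℝ`. -/
noncomputable abbrev gaussianPi (ι : Type*) [Fintype ι] : Measure (ι → ℝ) :=
  Measure.pi fun _ : ι => gaussianReal 0 1

/-! ### Gaussian integration by parts -/

section IntegrationByParts

/-- Resampling one coordinate independently preserves a product measure. This isolates a single
coordinate by Fubini without splitting the index type. -/
theorem measurePreserving_update_gaussianPi {ι : Type*} [Fintype ι] [DecidableEq ι] (i : ι) :
    MeasurePreserving (fun p : (ι → ℝ) × ℝ => Function.update p.1 i p.2)
      ((gaussianPi ι).prod (gaussianReal 0 1)) (gaussianPi ι) := by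
  have hm : Measurable fun p : (ι → ℝ) × ℝ => Function.update p.1 i p.2 := by
    refine measurable_pi_lambda _ fun j => ?_
    by_cases h : j = i
    · subst h; simpa using measurable_snd
    · simp only [Function.update_of_ne h]
      exact (measurable_pi_apply j).comp measurable_fst
  refine ⟨hm, (Measure.pi_eq fun s hs => ?_).symm⟩
  rw [Measure.map_apply hm (MeasurableSet.univ_pi hs)]
  have : (fun p : (ι → ℝ) × ℝ => Function.update p.1 i p.2) ⁻¹' Set.univ.pi s
      = (Set.univ.pi (Function.update s i Set.univ)) ×ˢ s i := by
    ext p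
    simp only [Set.mem_preimage, Set.mem_pi, Set.mem_univ, true_imp_iff, Set.mem_prod]
    constructor
    · intro h
      refine ⟨fun j => ?_, by simpa using h i⟩
      by_cases hj : j = i
      · subst hj; simp
      · simpa [Function.update_of_ne hj] using h j
    · rintro ⟨h, h'⟩ j
      by_cases hj : j = i
      · subst hj; simpa using h'
      · simpa [Function.update_of_ne hj] using h j
  rw [this, Measure.prod_prod, Measure.pi_pi, ← Finset.mul_prod_erase _ _ (Finset.mem_univ i),
    ← Finset.mul_prod_erase (Finset.univ) (fun j => gaussianReal 0 1 (s j)) (Finset.mem_univ i)]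
  simp only [Function.update_self, measure_univ, one_mul]
  rw [mul_comm]
  congr 1
  refine Finset.prod_congr rfl fun j hj => ?_
  rw [Function.update_of_ne (Finset.ne_of_mem_erase hj)]

/-- Gaussian integration by parts in one variable. -/
theorem integral_mul_gaussianReal {f f' : ℝ → ℝ} {C : ℝ} (hf : ∀ x, HasDerivAt f (f' x) x)
    (hf' : Continuous f') (hC : ∀ x, |f x| ≤ C) (hC' : ∀ x, |f' x| ≤ C) :
    ∫ x, x * f x ∂gaussianReal 0 1 = ∫ x, f' x ∂gaussianReal 0 1 := by
  have hpdf : gaussianPDFReal 0 1 = fun x => (√(2 * Real.pi))⁻¹ * Real.exp (-x ^ 2 / 2) := by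
    rw [gaussianPDFReal_def]; simp
  have hfc : Continuous f := continuous_iff_continuousAt.2 fun x => (hf x).continuousAt
  -- The density solves v' = -x v, so the factor x is absorbed by a derivative.
  have hv : ∀ x, HasDerivAt (gaussianPDFReal 0 1) (-(x * gaussianPDFReal 0 1 x)) x := by
    intro x
    rw [hpdf]
    have h1 : HasDerivAt (fun x : ℝ => -x ^ 2 / 2) (-x) x := by
      exact (((hasDerivAt_pow 2 x).neg).div_const 2).congr_deriv (by norm_num; ring)
    have := (h1.exp).const_mul (√(2 * Real.pi))⁻¹
    exact this.congr_deriv (by ring)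
  have hpi : Integrable (gaussianPDFReal 0 1) := integrable_gaussianPDFReal 0 1
  have hxi : Integrable fun x : ℝ => x * gaussianPDFReal 0 1 x := by
    rw [hpdf]
    have := (integrable_mul_exp_neg_mul_sq (b := 1 / 2) (by norm_num)).const_mul
      (√(2 * Real.pi))⁻¹
    refine this.congr (Eventually.of_forall fun x => ?_)
    simp only
    rw [show -(1 / 2) * x ^ 2 = -x ^ 2 / 2 by ring]
    ring
  have hb : ∀ {g h : ℝ → ℝ}, Continuous g → (∀ x, |g x| ≤ C) → Integrable h →
      Integrable fun x => g x * h x := fun hg hgC hh =>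
    hh.bdd_mul hg.aestronglyMeasurable (Eventually.of_forall fun x => by simpa using hgC x)
  have key := integral_mul_deriv_eq_deriv_mul_of_integrable (u := f) (u' := f')
    (v := gaussianPDFReal 0 1) (v' := fun x => -(x * gaussianPDFReal 0 1 x))
    (fun x _ => hf x) (fun x _ => hv x) (hb hfc hC hxi.neg) (hb hf' hC' hpi) (hb hfc hC hpi)
  rw [integral_gaussianReal_eq_integral_smul one_ne_zero,
    integral_gaussianReal_eq_integral_smul one_ne_zero]
  simp only [smul_eq_mul]
  have e1 : ∀ x, gaussianPDFReal 0 1 x * (x * f x) = -(f x * -(x * gaussianPDFReal 0 1 x)) := by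
    intro x; ring
  simp_rw [e1]
  rw [integral_neg, key, neg_neg]
  exact integral_congr_ae (Eventually.of_forall fun x => mul_comm _ _)

variable {ι : Type*} [Fintype ι]

theorem integrable_eval_gaussianPi (i : ι) : Integrable (fun x : ι → ℝ => x i) (gaussianPi ι) :=
  integrable_comp_eval (μ := fun _ : ι => gaussianReal 0 1) (f := fun x : ℝ => x)
    ((memLp_id_gaussianReal 1).integrable (by simp))

/-- Gaussian integration by parts in one coordinate. -/
theorem integral_mul_gaussianPi [DecidableEq ι] {f f' : (ι → ℝ) → ℝ} {C : ℝ} (i : ι)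
    (hf : ∀ x y, HasDerivAt (fun z => f (Function.update x i z)) (f' (Function.update x i y)) y)
    (hfc : Continuous f) (hf' : Continuous f') (hC : ∀ x, |f x| ≤ C) (hC' : ∀ x, |f' x| ≤ C) :
    ∫ x, x i * f x ∂gaussianPi ι = ∫ x, f' x ∂gaussianPi ι := by
  have hmp := measurePreserving_update_gaussianPi i
  have hint : Integrable (fun x : ι → ℝ => x i * f x) (gaussianPi ι) :=
    (integrable_eval_gaussianPi i).mul_bdd hfc.aestronglyMeasurable
      (Eventually.of_forall fun x => by simpa using hC x)
  have hint' : Integrable f' (gaussianPi ι) :=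
    Integrable.of_bound hf'.aestronglyMeasurable C
      (Eventually.of_forall fun x => by simpa using hC' x)
  rw [← hmp.map_eq] at hint hint'
  rw [← hmp.map_eq, integral_map hmp.aemeasurable hint.aestronglyMeasurable,
    integral_map hmp.aemeasurable hint'.aestronglyMeasurable,
    integral_prod (fun p : (ι → ℝ) × ℝ => Function.update p.1 i p.2 i
      * f (Function.update p.1 i p.2)) (hint.comp_measurable hmp.measurable),
    integral_prod (fun p : (ι → ℝ) × ℝ => f' (Function.update p.1 i p.2))
      (hint'.comp_measurable hmp.measurable)]
  refine integral_congr_ae (Eventually.of_forall fun x => ?_)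
  simp only [Function.update_self]
  exact integral_mul_gaussianReal (hf x)
    (hf'.comp (continuous_const.update i continuous_id)) (fun _ => hC _) (fun _ => hC' _)

end IntegrationByParts

/-! ### Sub-Gaussian concentration for coordinatewise Lipschitz functions -/

section Concentration

/-- `F` is `ℓ`-Lipschitz for the `ℓ¹` distance on `ι → ℝ`. -/
def L1Lipschitz {ι : Type*} [Fintype ι] (l : ℝ) (F : (ι → ℝ) → ℝ) : Prop :=
  ∀ x y, |F x - F y| ≤ l * ∑ i, |x i - y i|

theorem integrable_exp_abs_gaussianReal (c : ℝ) :
    Integrable (fun x => Real.exp (c * |x|)) (gaussianReal 0 1) :=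
  integrable_exp_mul_abs (integrable_exp_mul_gaussianReal c) (integrable_exp_mul_gaussianReal (-c))

theorem integral_exp_mul_gaussianReal (t : ℝ) :
    ∫ x, Real.exp (t * x) ∂gaussianReal 0 1 = Real.exp (t ^ 2 / 2) := by
  simpa [mgf] using congrFun (mgf_fun_id_gaussianReal (μ := 0) (v := 1)) t

variable {ι : Type*} [Fintype ι] {l : ℝ} {F : (ι → ℝ) → ℝ}

theorem L1Lipschitz.continuous (hF : L1Lipschitz l F) : Continuous F := by
  rw [continuous_iff_continuousAt]
  intro y
  rw [ContinuousAt, tendsto_iff_dist_tendsto_zero]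
  have hc : Continuous fun x : ι → ℝ => l * ∑ i, |x i - y i| := by fun_prop
  have h0 : Tendsto (fun x : ι → ℝ => l * ∑ i, |x i - y i|) (𝓝 y) (𝓝 0) := by
    simpa using hc.tendsto y
  exact squeeze_zero (fun _ => dist_nonneg) (fun x => by rw [Real.dist_eq]; exact hF x y) h0

theorem L1Lipschitz.integrable_exp (hF : L1Lipschitz l F) (s : ℝ) :
    Integrable (fun x => Real.exp (s * F x)) (gaussianPi ι) := by
  have h1 : Integrable (fun x : ι → ℝ => ∏ i, Real.exp (|s| * l * |x i|)) (gaussianPi ι) :=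
    Integrable.fintype_prod fun _ => integrable_exp_abs_gaussianReal _
  refine (h1.const_mul (Real.exp (|s| * |F 0|))).mono'
    (by have := hF.continuous; fun_prop) (Eventually.of_forall fun x => ?_)
  rw [Real.norm_eq_abs, Real.abs_exp, ← Real.exp_sum, ← Real.exp_add, Real.exp_le_exp]
  have h2 := hF x 0
  have h3 : |F x| ≤ |F 0| + l * ∑ i, |x i| := by
    have : |F x| ≤ |F x - F 0| + |F 0| := by simpa using abs_add_le (F x - F 0) (F 0)
    simp only [Pi.zero_apply, sub_zero] at h2
    linarith
  calc s * F x ≤ |s| * |F x| := by rw [← abs_mul]; exact le_abs_self _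
    _ ≤ |s| * (|F 0| + l * ∑ i, |x i|) := by gcongr
    _ = _ := by rw [← Finset.mul_sum]; ring

theorem L1Lipschitz.integrable (hF : L1Lipschitz l F) : Integrable F (gaussianPi ι) := by
  refine ((hF.integrable_exp 1).add (hF.integrable_exp (-1))).mono'
    hF.continuous.aestronglyMeasurable (Eventually.of_forall fun x => ?_)
  have h1 := Real.add_one_le_exp (1 * F x)
  have h2 := Real.add_one_le_exp (-1 * F x)
  have h3 := Real.exp_pos (1 * F x)
  have h4 := Real.exp_pos (-1 * F x)
  rw [Real.norm_eq_abs, Pi.add_apply, abs_le]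
  constructor <;> linarith

/-- A Lipschitz function of one Gaussian variable is sub-Gaussian. -/
theorem integral_exp_sub_integral_le {f : ℝ → ℝ} (hl : 0 ≤ l)
    (hf : ∀ x y, |f x - f y| ≤ l * |x - y|) (hi : Integrable f (gaussianReal 0 1))
    (s : ℝ) (he : ∀ s, Integrable (fun x => Real.exp (s * f x)) (gaussianReal 0 1)) :
    ∫ x, Real.exp (s * (f x - ∫ y, f y ∂gaussianReal 0 1)) ∂gaussianReal 0 1
      ≤ Real.exp (s ^ 2 * l ^ 2) := by
  set γ := gaussianReal 0 1
  have hp : ∀ s t, Integrable (fun p : ℝ × ℝ => Real.exp (s * f p.1) * Real.exp (t * f p.2))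
      (γ.prod γ) := fun s t => (he s).mul_prod (he t)
  have hq : ∀ s t : ℝ, Integrable (fun p : ℝ × ℝ => Real.exp (s * p.1) * Real.exp (t * p.2))
      (γ.prod γ) := fun s t =>
    (integrable_exp_mul_gaussianReal s).mul_prod (integrable_exp_mul_gaussianReal t)
  -- Jensen replaces the mean of `f` by an independent copy of `f`.
  have jensen : Real.exp (-s * ∫ y, f y ∂γ) ≤ ∫ y, Real.exp (-s * f y) ∂γ := by
    rw [← integral_const_mul]
    exact convexOn_exp.map_integral_le Real.continuous_exp.continuousOn isClosed_univ
      (by simp) (hi.const_mul _) (he (-s))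
  have h1 : ∫ x, Real.exp (s * (f x - ∫ y, f y ∂γ)) ∂γ
      ≤ ∫ p, Real.exp (s * f p.1) * Real.exp (-s * f p.2) ∂(γ.prod γ) := by
    rw [integral_prod_mul (fun x => Real.exp (s * f x)) (fun x => Real.exp (-s * f x))]
    have : ∀ x, Real.exp (s * (f x - ∫ y, f y ∂γ))
        = Real.exp (s * f x) * Real.exp (-s * ∫ y, f y ∂γ) := fun x => by
      rw [← Real.exp_add]; ring_nf
    simp_rw [this]
    rw [integral_mul_const]
    exact mul_le_mul_of_nonneg_left jensen (integral_nonneg fun _ => (Real.exp_pos _).le)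
  -- Adding the integral with the two copies exchanged produces a cosh, which is increasing in the
  -- absolute value of its argument. The Lipschitz bound therefore applies although the sign of f x
  -- - f y is unknown.
  have h2 : ∫ p, Real.exp (s * f p.1) * Real.exp (-s * f p.2) ∂(γ.prod γ)
      = ∫ p, Real.exp (-s * f p.1) * Real.exp (s * f p.2) ∂(γ.prod γ) := by
    rw [integral_prod_mul (fun x => Real.exp (s * f x)) (fun x => Real.exp (-s * f x)),
      integral_prod_mul (fun x => Real.exp (-s * f x)) (fun x => Real.exp (s * f x)), mul_comm]
  have h3 : ∫ p, (Real.exp (s * f p.1) * Real.exp (-s * f p.2)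
        + Real.exp (-s * f p.1) * Real.exp (s * f p.2)) ∂(γ.prod γ)
      ≤ ∫ p, (Real.exp (s * l * p.1) * Real.exp (-(s * l) * p.2)
        + Real.exp (-(s * l) * p.1) * Real.exp (s * l * p.2)) ∂(γ.prod γ) := by
    refine integral_mono ((hp _ _).add (hp _ _)) ((hq _ _).add (hq _ _)) fun p => ?_
    have hc : ∀ a : ℝ, Real.exp a + Real.exp (-a) = 2 * Real.cosh a := fun a => by
      rw [Real.cosh_eq]; ring
    simp only [← Real.exp_add]
    rw [show s * f p.1 + -s * f p.2 = s * (f p.1 - f p.2) by ring,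
      show -s * f p.1 + s * f p.2 = -(s * (f p.1 - f p.2)) by ring,
      show s * l * p.1 + -(s * l) * p.2 = s * l * (p.1 - p.2) by ring,
      show -(s * l) * p.1 + s * l * p.2 = -(s * l * (p.1 - p.2)) by ring, hc, hc]
    refine mul_le_mul_of_nonneg_left (Real.cosh_le_cosh.2 ?_) (by norm_num)
    rw [abs_mul, abs_mul, abs_mul, abs_of_nonneg hl, mul_assoc]
    exact mul_le_mul_of_nonneg_left (hf _ _) (abs_nonneg _)
  rw [integral_add (hp _ _) (hp _ _), integral_add (hq _ _) (hq _ _), ← h2] at h3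
  rw [integral_prod_mul (fun x => Real.exp (s * l * x)) (fun x => Real.exp (-(s * l) * x)),
    integral_prod_mul (fun x => Real.exp (-(s * l) * x)) (fun x => Real.exp (s * l * x)),
    integral_exp_mul_gaussianReal, integral_exp_mul_gaussianReal, ← Real.exp_add, ← Real.exp_add] at h3
  have h4 : (s * l) ^ 2 / 2 + (-(s * l)) ^ 2 / 2 = s ^ 2 * l ^ 2 := by ring
  have h5 : (-(s * l)) ^ 2 / 2 + (s * l) ^ 2 / 2 = s ^ 2 * l ^ 2 := by ring
  rw [h4, h5] at h3
  linarith

theorem L1Lipschitz.comp_equiv {κ : Type*} [Fintype κ] (hF : L1Lipschitz l F) (e : ι ≃ κ) :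
    L1Lipschitz l fun x : κ → ℝ => F fun i => x (e i) := fun x y => by
  have := hF (fun i => x (e i)) fun i => y (e i)
  rwa [Equiv.sum_comp e fun i => |x i - y i|] at this

theorem integral_gaussianPi_comp_equiv {κ : Type*} [Fintype κ] (e : ι ≃ κ) (G : (ι → ℝ) → ℝ) :
    ∫ x : κ → ℝ, G (fun i => x (e i)) ∂gaussianPi κ = ∫ x, G x ∂gaussianPi ι := by
  rw [← (measurePreserving_piCongrLeft (fun _ : ι => gaussianReal 0 1) e.symm).integral_comp']
  refine integral_congr_ae (Eventually.of_forall fun x => ?_)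
  simp only
  congr 1
  ext i
  simpa using (MeasurableEquiv.piCongrLeft_apply_apply (β := fun _ : ι => ℝ) e.symm x (e i)).symm

/-- Induction on the number of coordinates: averaging out the first one leaves a function with the
same Lipschitz constant, and the conditional fluctuation in that coordinate costs one factor exp(s²
l²), uniformly in the others. -/
theorem integral_exp_sub_integral_le_fin {k : ℕ} {F : (Fin k → ℝ) → ℝ} (hl : 0 ≤ l)
    (hF : L1Lipschitz l F) (s : ℝ) :
    ∫ x, Real.exp (s * (F x - ∫ y, F y ∂gaussianPi (Fin k))) ∂gaussianPi (Fin k)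
      ≤ Real.exp (k * (s ^ 2 * l ^ 2)) := by
  induction k with
  | zero =>
    have : ∀ x, F x = F 0 := fun x => by rw [Subsingleton.elim x 0]
    simp_rw [this]
    simp
  | succ k ih =>
    set γ := gaussianReal 0 1
    have hmp := (measurePreserving_piFinSuccAbove (fun _ : Fin (k + 1) => γ) 0).symm
    have hcons : ∀ p, (MeasurableEquiv.piFinSuccAbove (fun _ : Fin (k + 1) => ℝ) 0).symm p
        = (Fin.cons p.1 p.2 : Fin (k + 1) → ℝ) := fun p => by
      simp [MeasurableEquiv.piFinSuccAbove, Fin.insertNthEquiv, Fin.insertNth_zero']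
    have hint : ∀ G : (Fin (k + 1) → ℝ) → ℝ, ∫ x, G x ∂gaussianPi (Fin (k + 1))
        = ∫ p, G (Fin.cons p.1 p.2) ∂γ.prod (gaussianPi (Fin k)) := fun G => by
      rw [← hmp.integral_comp']
      exact integral_congr_ae (Eventually.of_forall fun p => by simp only [hcons])
    have hintegrable : ∀ {G : (Fin (k + 1) → ℝ) → ℝ}, Integrable G (gaussianPi (Fin (k + 1))) →
        Integrable (fun p : ℝ × (Fin k → ℝ) => G (Fin.cons p.1 p.2))
          (γ.prod (gaussianPi (Fin k))) := fun {G} hG => by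
      have := (hmp.integrable_comp_emb (MeasurableEquiv.measurableEmbedding _)).2 hG
      exact this.congr (Eventually.of_forall fun p => by simp only [Function.comp, hcons])
    have hy : ∀ z y y', |F (Fin.cons y z) - F (Fin.cons y' z)| ≤ l * |y - y'| := fun z y y' => by
      simpa [Fin.sum_univ_succ] using hF (Fin.cons y z) (Fin.cons y' z)
    have hz : ∀ y z z', |F (Fin.cons y z) - F (Fin.cons y z')| ≤ l * ∑ i, |z i - z' i| :=
      fun y z z' => by simpa [Fin.sum_univ_succ] using hF (Fin.cons y z) (Fin.cons y z')
    -- Each slice is viewed as a function on `Unit → ℝ`, so that the integrability lemmas above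
    -- apply to it.
    have hl1 : ∀ z, L1Lipschitz (ι := Unit) l fun u => F (Fin.cons (u ()) z) := fun z u v => by
      simpa using hy z (u ()) (v ())
    have hun := measurePreserving_funUnique γ Unit
    have hi1 : ∀ z, Integrable (fun y => F (Fin.cons y z)) γ := fun z =>
      (hun.integrable_comp_emb (MeasurableEquiv.measurableEmbedding _)).1 (hl1 z).integrable
    have he1 : ∀ z s, Integrable (fun y => Real.exp (s * F (Fin.cons y z))) γ := fun z s =>
      (hun.integrable_comp_emb (MeasurableEquiv.measurableEmbedding _)).1 ((hl1 z).integrable_exp s)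
    set Fb : (Fin k → ℝ) → ℝ := fun z => ∫ y, F (Fin.cons y z) ∂γ with hFb
    have hFbl : L1Lipschitz l Fb := fun z z' => by
      rw [hFb]
      simp only
      rw [← integral_sub (hi1 z) (hi1 z')]
      have := norm_integral_le_of_norm_le_const (μ := γ)
        (f := fun y => F (Fin.cons y z) - F (Fin.cons y z'))
        (Eventually.of_forall fun y => (Real.norm_eq_abs _).trans_le (hz y z z'))
      simpa only [Real.norm_eq_abs, probReal_univ, mul_one] using this
    have hmean : ∫ x, F x ∂gaussianPi (Fin (k + 1)) = ∫ z, Fb z ∂gaussianPi (Fin k) := by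
      rw [hint, integral_prod_symm _ (hintegrable hF.integrable)]
    rw [hmean, hint]
    set m := ∫ z, Fb z ∂gaussianPi (Fin k)
    have hexpint : Integrable (fun x => Real.exp (s * (F x - m))) (gaussianPi (Fin (k + 1))) := by
      have := (hF.integrable_exp s).mul_const (Real.exp (-s * m))
      refine this.congr (Eventually.of_forall fun x => ?_)
      simp only
      rw [← Real.exp_add]; ring_nf
    have hexpint' : Integrable (fun x => Real.exp (s * (Fb x - m))) (gaussianPi (Fin k)) := by
      have := (hFbl.integrable_exp s).mul_const (Real.exp (-s * m))
      refine this.congr (Eventually.of_forall fun x => ?_)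
      simp only
      rw [← Real.exp_add]; ring_nf
    rw [integral_prod_symm _ (hintegrable hexpint)]
    calc ∫ z, ∫ y, Real.exp (s * (F (Fin.cons y z) - m)) ∂γ ∂gaussianPi (Fin k)
        ≤ ∫ z, Real.exp (s ^ 2 * l ^ 2) * Real.exp (s * (Fb z - m)) ∂gaussianPi (Fin k) := by
          refine integral_mono (hintegrable hexpint).integral_prod_right
            (hexpint'.const_mul _) fun z => ?_
          have e : ∀ y, Real.exp (s * (F (Fin.cons y z) - m))
              = Real.exp (s * (F (Fin.cons y z) - Fb z)) * Real.exp (s * (Fb z - m)) := fun y => by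
            rw [← Real.exp_add]; ring_nf
          simp_rw [e]
          rw [integral_mul_const]
          exact mul_le_mul_of_nonneg_right
            (integral_exp_sub_integral_le hl (hy z) (hi1 z) s (he1 z)) (Real.exp_pos _).le
      _ = Real.exp (s ^ 2 * l ^ 2) * ∫ z, Real.exp (s * (Fb z - m)) ∂gaussianPi (Fin k) :=
          integral_const_mul _ _
      _ ≤ Real.exp (s ^ 2 * l ^ 2) * Real.exp (k * (s ^ 2 * l ^ 2)) :=
          mul_le_mul_of_nonneg_left (ih hFbl) (Real.exp_pos _).le
      _ = _ := by rw [← Real.exp_add]; push_cast; ring_nf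

/-- A function of independent Gaussian variables that is Lipschitz in each is sub-Gaussian. -/
theorem L1Lipschitz.integral_exp_sub_integral_le (hF : L1Lipschitz l F) (hl : 0 ≤ l) (s : ℝ) :
    ∫ x, Real.exp (s * (F x - ∫ y, F y ∂gaussianPi ι)) ∂gaussianPi ι
      ≤ Real.exp (Fintype.card ι * (s ^ 2 * l ^ 2)) := by
  let e := Fintype.equivFin ι
  have := integral_exp_sub_integral_le_fin hl (hF.comp_equiv e) s
  rw [integral_gaussianPi_comp_equiv e F] at this
  rwa [integral_gaussianPi_comp_equiv e
    fun x => Real.exp (s * (F x - ∫ y, F y ∂gaussianPi ι))] at this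

theorem L1Lipschitz.neg (hF : L1Lipschitz l F) : L1Lipschitz l fun x => -F x := fun x y => by
  rw [neg_sub_neg, abs_sub_comm]; exact hF x y

/-- Chernoff's bound; `s` is left free to be optimised by the user. -/
theorem L1Lipschitz.measure_ge_le (hF : L1Lipschitz l F) (hl : 0 ≤ l) {s t : ℝ} (hs : 0 ≤ s) :
    (gaussianPi ι).real {x | t ≤ F x - ∫ y, F y ∂gaussianPi ι}
      ≤ Real.exp (-s * t + Fintype.card ι * (s ^ 2 * l ^ 2)) := by
  have hexpint : Integrable (fun x => Real.exp (s * (F x - ∫ y, F y ∂gaussianPi ι)))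
      (gaussianPi ι) := by
    refine ((hF.integrable_exp s).mul_const
      (Real.exp (-s * ∫ y, F y ∂gaussianPi ι))).congr (Eventually.of_forall fun x => ?_)
    simp only
    rw [← Real.exp_add]; ring_nf
  refine (measure_ge_le_exp_mul_mgf t hs hexpint).trans ?_
  rw [Real.exp_add]
  exact mul_le_mul_of_nonneg_left (hF.integral_exp_sub_integral_le hl s) (Real.exp_pos _).le

/-- Gaussian concentration for functions that are Lipschitz in each coordinate. -/
theorem L1Lipschitz.measure_abs_ge_le (hF : L1Lipschitz l F) (hl : 0 ≤ l) {s t : ℝ}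
    (hs : 0 ≤ s) :
    (gaussianPi ι).real {x | t ≤ |F x - ∫ y, F y ∂gaussianPi ι|}
      ≤ 2 * Real.exp (-s * t + Fintype.card ι * (s ^ 2 * l ^ 2)) := by
  have h1 := hF.measure_ge_le hl (t := t) hs
  have h2 := hF.neg.measure_ge_le hl (t := t) hs
  refine (measureReal_mono (fun x hx => ?_)).trans ((measureReal_union_le _ _).trans
    ((add_le_add h1 h2).trans_eq (two_mul _).symm))
  rw [Set.mem_ofPred_eq, le_abs] at hx
  rcases hx with h | h
  · exact Or.inl h
  · right
    rw [Set.mem_ofPred_eq, integral_neg]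
    linarith

end Concentration

/-! ### Free energies of finite Gaussian systems and their Gibbs weights -/

section LogSumExp

variable {S ι κ : Type*} [Fintype S] [Fintype ι] [Fintype κ]

/-- The free energy `log ∑_σ exp ⟨c σ, x⟩`. -/
noncomputable def logSumExp (c : S → ι → ℝ) (x : ι → ℝ) : ℝ :=
  Real.log (∑ σ, Real.exp (∑ i, c σ i * x i))

/-- The Gibbs weights `exp ⟨c σ, x⟩ / ∑_τ exp ⟨c τ, x⟩`. -/
noncomputable def gibbsWeight (c : S → ι → ℝ) (x : ι → ℝ) (σ : S) : ℝ :=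
  Real.exp (∑ i, c σ i * x i) / ∑ τ, Real.exp (∑ i, c τ i * x i)

variable [Nonempty S]

theorem sum_exp_pos (c : S → ι → ℝ) (x : ι → ℝ) : 0 < ∑ σ, Real.exp (∑ i, c σ i * x i) :=
  Finset.sum_pos (fun _ _ => Real.exp_pos _) Finset.univ_nonempty

theorem gibbsWeight_nonneg (c : S → ι → ℝ) (x : ι → ℝ) (σ : S) : 0 ≤ gibbsWeight c x σ :=
  div_nonneg (Real.exp_pos _).le (sum_exp_pos c x).le

theorem sum_gibbsWeight (c : S → ι → ℝ) (x : ι → ℝ) : ∑ σ, gibbsWeight c x σ = 1 := by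
  simp only [gibbsWeight]
  rw [← Finset.sum_div, div_self (sum_exp_pos c x).ne']

theorem gibbsWeight_le_one (c : S → ι → ℝ) (x : ι → ℝ) (σ : S) : gibbsWeight c x σ ≤ 1 := by
  rw [← sum_gibbsWeight c x]
  exact Finset.single_le_sum (fun τ _ => gibbsWeight_nonneg c x τ) (Finset.mem_univ σ)

theorem abs_gibbsWeight_le_one (c : S → ι → ℝ) (x : ι → ℝ) (σ : S) : |gibbsWeight c x σ| ≤ 1 := by
  rw [abs_of_nonneg (gibbsWeight_nonneg c x σ)]; exact gibbsWeight_le_one c x σ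

theorem abs_sum_gibbsWeight_mul_le {C : ℝ} (c : S → ι → ℝ) (x : ι → ℝ) {u : S → ℝ}
    (hu : ∀ σ, |u σ| ≤ C) : |∑ σ, gibbsWeight c x σ * u σ| ≤ C := by
  calc |∑ σ, gibbsWeight c x σ * u σ| ≤ ∑ σ, |gibbsWeight c x σ * u σ| :=
        Finset.abs_sum_le_sum_abs _ _
    _ ≤ ∑ σ, gibbsWeight c x σ * C := Finset.sum_le_sum fun σ _ => by
        rw [abs_mul, abs_of_nonneg (gibbsWeight_nonneg c x σ)]
        exact mul_le_mul_of_nonneg_left (hu σ) (gibbsWeight_nonneg c x σ)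
    _ = C := by rw [← Finset.sum_mul, sum_gibbsWeight, one_mul]

theorem continuous_gibbsWeight (c : S → ι → ℝ) (σ : S) : Continuous fun x => gibbsWeight c x σ := by
  unfold gibbsWeight
  exact Continuous.div (by fun_prop) (by fun_prop) fun x => (sum_exp_pos c x).ne'

/-- Moving from `y` to `x` raises every exponent by at most l ∑ |x i - y i|, a factor that leaves
the sum uniformly in σ. -/
theorem logSumExp_le_add {c : S → ι → ℝ} {l : ℝ} (hc : ∀ σ i, |c σ i| ≤ l) (x y : ι → ℝ) :
    logSumExp c x ≤ logSumExp c y + l * ∑ i, |x i - y i| := by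
  unfold logSumExp
  rw [Real.log_le_iff_le_exp (sum_exp_pos c x), Real.exp_add, Real.exp_log (sum_exp_pos c y),
    Finset.sum_mul]
  refine Finset.sum_le_sum fun σ _ => ?_
  rw [← Real.exp_add, Real.exp_le_exp, ← sub_le_iff_le_add', ← Finset.sum_sub_distrib,
    Finset.mul_sum]
  refine Finset.sum_le_sum fun i _ => ?_
  rw [← mul_sub]
  refine (le_abs_self _).trans ?_
  rw [abs_mul]
  exact mul_le_mul_of_nonneg_right (hc σ i) (abs_nonneg _)

theorem l1Lipschitz_logSumExp {c : S → ι → ℝ} {l : ℝ} (hc : ∀ σ i, |c σ i| ≤ l) :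
    L1Lipschitz l (logSumExp c) := fun x y => by
  have h1 := logSumExp_le_add hc x y
  have h2 := logSumExp_le_add hc y x
  simp_rw [abs_sub_comm (y _)] at h2
  rw [abs_le]
  constructor <;> linarith

theorem hasDerivAt_logSumExp {c : ℝ → S → ι → ℝ} {c' : S → ι → ℝ} {t : ℝ}
    (hc : ∀ σ i, HasDerivAt (fun s => c s σ i) (c' σ i) t) (x : ι → ℝ) :
    HasDerivAt (fun s => logSumExp (c s) x)
      (∑ σ, gibbsWeight (c t) x σ * ∑ i, c' σ i * x i) t := by
  have h1 : ∀ σ, HasDerivAt (fun s => ∑ i, c s σ i * x i) (∑ i, c' σ i * x i) t := fun σ =>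
    HasDerivAt.fun_sum fun i _ => (hc σ i).mul_const (x i)
  refine ((HasDerivAt.fun_sum fun σ _ => (h1 σ).exp).log (sum_exp_pos (c t) x).ne').congr_deriv ?_
  rw [Finset.sum_div]
  exact Finset.sum_congr rfl fun σ _ => by rw [gibbsWeight]; ring

theorem hasDerivAt_gibbsWeight_update [DecidableEq ι] (c : S → ι → ℝ) (x : ι → ℝ) (i : ι) (y : ℝ)
    (σ : S) :
    HasDerivAt (fun z => gibbsWeight c (Function.update x i z) σ)
      (gibbsWeight c (Function.update x i y) σ *
        (c σ i - ∑ τ, gibbsWeight c (Function.update x i y) τ * c τ i)) y := by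
  have h1 : ∀ τ, HasDerivAt (fun z => ∑ j, c τ j * Function.update x i z j) (c τ i) y := fun τ => by
    have h : ∀ j ∈ Finset.univ, HasDerivAt (fun z => c τ j * Function.update x i z j)
        (if j = i then c τ i else 0) y := fun j _ => by
      by_cases hj : j = i
      · subst hj
        simpa using (hasDerivAt_id y).const_mul (c τ j)
      · simpa [Function.update_of_ne hj, hj] using hasDerivAt_const y (c τ j * x j)
    exact (HasDerivAt.fun_sum h).congr_deriv (by simp)
  have hZ := sum_exp_pos c (Function.update x i y)
  unfold gibbsWeight
  refine ((h1 σ).exp.div (HasDerivAt.fun_sum fun τ _ => (h1 τ).exp) hZ.ne').congr_deriv ?_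
  simp_rw [div_mul_eq_mul_div]
  rw [← Finset.sum_div]
  field_simp

/-! ### Interpolation and Gaussian comparison -/

/-- Gaussian integration by parts for the Gibbs weights. -/
theorem integral_mul_gibbsWeight [DecidableEq ι] (c : S → ι → ℝ) (i : ι) (σ : S) :
    ∫ x, x i * gibbsWeight c x σ ∂gaussianPi ι
      = ∫ x, gibbsWeight c x σ * (c σ i - ∑ τ, gibbsWeight c x τ * c τ i) ∂gaussianPi ι := by
  obtain ⟨C, hC⟩ : ∃ C, ∀ τ, |c τ i| ≤ C := by
    obtain ⟨C, hC⟩ := (Set.finite_range fun τ => |c τ i|).bddAbove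
    exact ⟨C, fun τ => hC ⟨τ, rfl⟩⟩
  have hC0 : 0 ≤ C := (abs_nonneg _).trans (hC σ)
  have hg := continuous_gibbsWeight c
  refine integral_mul_gaussianPi (C := 1 + 2 * C) i
    (fun x y => hasDerivAt_gibbsWeight_update c x i y σ) (hg σ) (by fun_prop)
    (fun x => ?_) fun x => ?_
  · linarith [abs_gibbsWeight_le_one c x σ]
  · have h1 := abs_sum_gibbsWeight_mul_le c x hC
    have h2 : |c σ i - ∑ τ, gibbsWeight c x τ * c τ i| ≤ 2 * C :=
      (abs_sub _ _).trans (by linarith [hC σ])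
    rw [abs_mul]
    have := mul_le_mul (abs_gibbsWeight_le_one c x σ) h2 (abs_nonneg _) zero_le_one
    linarith

/-- The Gaussian interpolation identity, as an inequality: if `⟨c' σ, c τ⟩ ≤ ⟨c' σ, c σ⟩` then the
mean of the derivative of the free energy in the direction `c'` is nonnegative. -/
theorem integral_sum_gibbsWeight_mul_nonneg {c c' : S → ι → ℝ}
    (h : ∀ σ τ, ∑ i, c' σ i * c τ i ≤ ∑ i, c' σ i * c σ i) :
    0 ≤ ∫ x, ∑ σ, gibbsWeight c x σ * ∑ i, c' σ i * x i ∂gaussianPi ι := by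
  classical
  have hg := continuous_gibbsWeight c
  have hi : ∀ σ i, Integrable (fun x : ι → ℝ => c' σ i * (x i * gibbsWeight c x σ))
      (gaussianPi ι) := fun σ i =>
    ((integrable_eval_gaussianPi i).mul_bdd (hg σ).aestronglyMeasurable
      (Eventually.of_forall fun x => by simpa using abs_gibbsWeight_le_one c x σ)).const_mul _
  have hj : ∀ σ i, Integrable (fun x : ι → ℝ => c' σ i * (gibbsWeight c x σ *
      (c σ i - ∑ τ, gibbsWeight c x τ * c τ i))) (gaussianPi ι) := fun σ i => by
    obtain ⟨C, hC⟩ : ∃ C, ∀ τ, |c τ i| ≤ C := by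
      obtain ⟨C, hC⟩ := (Set.finite_range fun τ => |c τ i|).bddAbove
      exact ⟨C, fun τ => hC ⟨τ, rfl⟩⟩
    refine (Integrable.of_bound (C := 1 * (2 * C)) (by fun_prop)
      (Eventually.of_forall fun x => ?_)).const_mul _
    have h1 := abs_sum_gibbsWeight_mul_le c x hC
    have h2 : |c σ i - ∑ τ, gibbsWeight c x τ * c τ i| ≤ 2 * C :=
      (abs_sub _ _).trans (by linarith [hC σ])
    rw [Real.norm_eq_abs, abs_mul]
    exact mul_le_mul (abs_gibbsWeight_le_one c x σ) h2 (abs_nonneg _) zero_le_one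
  have key : ∫ x, ∑ σ, gibbsWeight c x σ * ∑ i, c' σ i * x i ∂gaussianPi ι
      = ∫ x, ∑ σ, ∑ i, c' σ i * (gibbsWeight c x σ *
          (c σ i - ∑ τ, gibbsWeight c x τ * c τ i)) ∂gaussianPi ι := by
    rw [integral_finsetSum _ fun σ _ => integrable_finsetSum _ fun i _ => hj σ i]
    have e : ∀ x : ι → ℝ, ∑ σ, gibbsWeight c x σ * ∑ i, c' σ i * x i
        = ∑ σ, ∑ i, c' σ i * (x i * gibbsWeight c x σ) := fun x =>
      Finset.sum_congr rfl fun σ _ => by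
        rw [Finset.mul_sum]
        exact Finset.sum_congr rfl fun i _ => by ring
    simp_rw [e]
    rw [integral_finsetSum _ fun σ _ => integrable_finsetSum _ fun i _ => hi σ i]
    refine Finset.sum_congr rfl fun σ _ => ?_
    rw [integral_finsetSum _ fun i _ => hi σ i, integral_finsetSum _ fun i _ => hj σ i]
    refine Finset.sum_congr rfl fun i _ => ?_
    rw [integral_const_mul, integral_const_mul, integral_mul_gibbsWeight]
  rw [key]
  refine integral_nonneg fun x => Finset.sum_nonneg fun σ _ => ?_
  -- The weights sum to one, so the Gibbs average becomes a second replica τ and each term is an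
  -- average of the differences controlled by `h`.
  have e : ∑ i, c' σ i * (gibbsWeight c x σ * (c σ i - ∑ τ, gibbsWeight c x τ * c τ i))
      = gibbsWeight c x σ * ∑ τ, gibbsWeight c x τ *
        (∑ i, c' σ i * c σ i - ∑ i, c' σ i * c τ i) := by
    simp_rw [mul_sub, Finset.sum_sub_distrib]
    rw [← Finset.sum_mul, sum_gibbsWeight, one_mul, mul_sub]
    congr 1
    · rw [Finset.mul_sum]
      exact Finset.sum_congr rfl fun i _ => by ring
    · simp_rw [Finset.mul_sum]
      rw [Finset.sum_comm]
      exact Finset.sum_congr rfl fun i _ => Finset.sum_congr rfl fun τ _ => by ring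
  rw [e]
  exact mul_nonneg (gibbsWeight_nonneg c x σ) (Finset.sum_nonneg fun τ _ =>
    mul_nonneg (gibbsWeight_nonneg c x τ) (sub_nonneg.2 (h σ τ)))

theorem integrable_logSumExp (c : S → ι → ℝ) : Integrable (logSumExp c) (gaussianPi ι) := by
  obtain ⟨C, hC⟩ := (Set.finite_range fun p : S × ι => |c p.1 p.2|).bddAbove
  exact (l1Lipschitz_logSumExp (l := C) fun σ i => hC ⟨(σ, i), rfl⟩).integrable

/-- The mean free energy is differentiable along a smooth curve of covectors. -/
theorem hasDerivAt_integral_logSumExp {c c' : ℝ → S → ι → ℝ} {C : ℝ}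
    (hc : ∀ t σ i, HasDerivAt (fun s => c s σ i) (c' t σ i) t) (hC : ∀ t σ i, |c' t σ i| ≤ C)
    (t : ℝ) :
    HasDerivAt (fun s => ∫ x, logSumExp (c s) x ∂gaussianPi ι)
      (∫ x, ∑ σ, gibbsWeight (c t) x σ * ∑ i, c' t σ i * x i ∂gaussianPi ι) t := by
  have hg := fun σ => continuous_gibbsWeight (c t) σ
  refine (hasDerivAt_integral_of_dominated_loc_of_deriv_le (s := Set.univ)
    (bound := fun x => ∑ i, C * |x i|)
    (F' := fun t x => ∑ σ, gibbsWeight (c t) x σ * ∑ i, c' t σ i * x i)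
    univ_mem (Eventually.of_forall fun s => (integrable_logSumExp (c s)).aestronglyMeasurable)
    (integrable_logSumExp (c t))
    (Continuous.aestronglyMeasurable (by fun_prop)) (Eventually.of_forall fun x s _ => ?_)
    (integrable_finsetSum _ fun i _ => ((integrable_eval_gaussianPi i).abs.const_mul C))
    (Eventually.of_forall fun x s _ => hasDerivAt_logSumExp (hc s) x)).2
  refine abs_sum_gibbsWeight_mul_le _ _ fun σ => (Finset.abs_sum_le_sum_abs _ _).trans ?_
  refine Finset.sum_le_sum fun i _ => ?_
  rw [abs_mul]
  exact mul_le_mul_of_nonneg_right (hC s σ i) (abs_nonneg _)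

theorem integral_gaussianPi_sum (G : (ι ⊕ κ → ℝ) → ℝ) :
    ∫ z, G z ∂gaussianPi (ι ⊕ κ)
      = ∫ p, G (Sum.elim p.1 p.2) ∂(gaussianPi ι).prod (gaussianPi κ) := by
  rw [← (measurePreserving_sumPiEquivProdPi_symm
    fun _ : ι ⊕ κ => gaussianReal 0 1).integral_comp']
  refine integral_congr_ae (Eventually.of_forall fun p => ?_)
  simp only
  congr 1

/-- Gaussian comparison for the free energy: with equal variances, smaller covariances give a larger
mean free energy. -/
theorem integral_logSumExp_le_of_covariance_le {a : S → ι → ℝ} {b : S → κ → ℝ}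
    (hdiag : ∀ σ, ∑ i, a σ i * a σ i = ∑ i, b σ i * b σ i)
    (hle : ∀ σ τ, ∑ i, a σ i * a τ i ≤ ∑ i, b σ i * b τ i) :
    ∫ x, logSumExp b x ∂gaussianPi κ ≤ ∫ x, logSumExp a x ∂gaussianPi ι := by
  -- Rotation from `b` at t = 0 to `a` at t = π/2, acting on independent Gaussians. Unlike the path
  -- √t, √(1 - t), it is smooth up to the endpoints, and variances stay constant by `hdiag`.
  set c : ℝ → S → ι ⊕ κ → ℝ := fun t σ =>
    Sum.elim (fun i => Real.sin t * a σ i) fun i => Real.cos t * b σ i with hcdef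
  set c' : ℝ → S → ι ⊕ κ → ℝ := fun t σ =>
    Sum.elim (fun i => Real.cos t * a σ i) fun i => -Real.sin t * b σ i with hcdef'
  obtain ⟨A, hA⟩ := (Set.finite_range fun p : S × ι => |a p.1 p.2|).bddAbove
  obtain ⟨B, hB⟩ := (Set.finite_range fun p : S × κ => |b p.1 p.2|).bddAbove
  have hder : ∀ t σ i, HasDerivAt (fun s => c s σ i) (c' t σ i) t := by
    rintro t σ (i | i)
    · exact (Real.hasDerivAt_sin t).mul_const _
    · exact (Real.hasDerivAt_cos t).mul_const _
  have hbd : ∀ t σ i, |c' t σ i| ≤ max A B := by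
    rintro t σ (i | i)
    · have h1 : |a σ i| ≤ A := hA ⟨(σ, i), rfl⟩
      have h2 := mul_le_mul_of_nonneg_right (Real.abs_cos_le_one t) (abs_nonneg (a σ i))
      simp only [hcdef', Sum.elim_inl, abs_mul]
      exact (h2.trans (by linarith)).trans (le_max_left A B)
    · have h1 : |b σ i| ≤ B := hB ⟨(σ, i), rfl⟩
      have h2 := mul_le_mul_of_nonneg_right (Real.abs_sin_le_one t) (abs_nonneg (b σ i))
      simp only [hcdef', Sum.elim_inr, abs_mul, abs_neg]
      exact (h2.trans (by linarith)).trans (le_max_right A B)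
  have hφ := hasDerivAt_integral_logSumExp hder hbd
  have hcov : ∀ t σ τ, ∑ i, c' t σ i * c t τ i
      = Real.cos t * Real.sin t * (∑ i, a σ i * a τ i - ∑ i, b σ i * b τ i) := fun t σ τ => by
    simp only [hcdef, hcdef', Fintype.sum_sum_type, Sum.elim_inl, Sum.elim_inr]
    rw [mul_sub, Finset.mul_sum, Finset.mul_sum, sub_eq_add_neg, ← Finset.sum_neg_distrib]
    congr 1 <;> exact Finset.sum_congr rfl fun i _ => by ring
  have hmono : MonotoneOn (fun s => ∫ x, logSumExp (c s) x ∂gaussianPi (ι ⊕ κ))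
      (Set.Icc 0 (Real.pi / 2)) := by
    refine monotoneOn_of_deriv_nonneg (convex_Icc _ _)
      (fun t _ => (hφ t).continuousAt.continuousWithinAt)
      (fun t _ => (hφ t).differentiableAt.differentiableWithinAt) fun t ht => ?_
    rw [interior_Icc] at ht
    rw [(hφ t).deriv]
    -- The diagonal term vanishes by equality of variances; what remains has the sign of the
    -- covariance difference, since sin and cos are nonnegative on this interval.
    refine integral_sum_gibbsWeight_mul_nonneg fun σ τ => ?_
    rw [hcov, hcov, hdiag σ, sub_self, mul_zero]
    refine mul_nonpos_of_nonneg_of_nonpos (mul_nonneg ?_ ?_) (sub_nonpos.2 (hle σ τ))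
    · exact Real.cos_nonneg_of_mem_Icc ⟨by linarith [ht.1, Real.pi_pos], ht.2.le⟩
    · exact Real.sin_nonneg_of_mem_Icc ⟨ht.1.le, by linarith [ht.2, Real.pi_pos]⟩
  have h := hmono (Set.left_mem_Icc.2 (by positivity)) (Set.right_mem_Icc.2 (by positivity))
    (by positivity : (0 : ℝ) ≤ Real.pi / 2)
  have h0 : ∫ x, logSumExp (c 0) x ∂gaussianPi (ι ⊕ κ) = ∫ x, logSumExp b x ∂gaussianPi κ := by
    rw [integral_gaussianPi_sum]
    simp only [logSumExp, hcdef, Fintype.sum_sum_type, Sum.elim_inl, Sum.elim_inr, Real.sin_zero,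
      Real.cos_zero, zero_mul, Finset.sum_const_zero, zero_add, one_mul]
    rw [integral_fun_snd (fun x : κ → ℝ => Real.log (∑ σ, Real.exp (∑ i, b σ i * x i)))]
    simp
  have h1 : ∫ x, logSumExp (c (Real.pi / 2)) x ∂gaussianPi (ι ⊕ κ)
      = ∫ x, logSumExp a x ∂gaussianPi ι := by
    rw [integral_gaussianPi_sum]
    simp only [logSumExp, hcdef, Fintype.sum_sum_type, Sum.elim_inl, Sum.elim_inr, Real.sin_pi_div_two,
      Real.cos_pi_div_two, zero_mul, Finset.sum_const_zero, add_zero, one_mul]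
    rw [integral_fun_fst (fun x : ι → ℝ => Real.log (∑ σ, Real.exp (∑ i, a σ i * x i)))]
    simp
  simp only [h0, h1] at h
  exact h

/-- The annealed bound on the mean free energy. -/
theorem integral_logSumExp_le {c : S → ι → ℝ} {l : ℝ} (hc : ∀ σ, ∑ i, c σ i ^ 2 ≤ l) :
    ∫ x, logSumExp c x ∂gaussianPi ι ≤ Real.log (Fintype.card S) + l / 2 := by
  have hi : ∀ σ, Integrable (fun x : ι → ℝ => Real.exp (∑ i, c σ i * x i)) (gaussianPi ι) :=
    fun σ => by
      simp_rw [Real.exp_sum]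
      exact Integrable.fintype_prod fun i => integrable_exp_mul_gaussianReal (c σ i)
  have hexp : ∀ x, Real.exp (logSumExp c x) = ∑ σ, Real.exp (∑ i, c σ i * x i) := fun x =>
    Real.exp_log (sum_exp_pos c x)
  have hie : Integrable (fun x => Real.exp (logSumExp c x)) (gaussianPi ι) := by
    simp_rw [hexp]
    exact integrable_finsetSum _ fun σ _ => hi σ
  have jensen : Real.exp (∫ x, logSumExp c x ∂gaussianPi ι)
      ≤ ∫ x, Real.exp (logSumExp c x) ∂gaussianPi ι :=
    convexOn_exp.map_integral_le Real.continuous_exp.continuousOn isClosed_univ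
      (by simp) (integrable_logSumExp c) hie
  rw [← Real.exp_le_exp, Real.exp_add,
    Real.exp_log (by exact_mod_cast Fintype.card_pos)]
  refine jensen.trans ?_
  simp_rw [hexp]
  rw [integral_finsetSum _ fun σ _ => hi σ, ← nsmul_eq_mul]
  refine Finset.sum_le_card_nsmul _ _ _ fun σ _ => ?_
  simp_rw [Real.exp_sum]
  rw [integral_fintype_prod_eq_prod (fun i x => Real.exp (c σ i * x))]
  simp_rw [integral_exp_mul_gaussianReal]
  rw [← Real.exp_sum, Real.exp_le_exp, ← Finset.sum_div]
  linarith [hc σ]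

end LogSumExp

/-! ### The Sherrington–Kirkpatrick mean free energy -/

section SherringtonKirkpatrick

theorem SpinConfig.toReal_mul_self {n : ℕ} (σ : SpinConfig n) (i : Fin n) :
    σ.toReal i * σ.toReal i = 1 := by
  rcases Int.units_eq_one_or (σ i) with h | h <;> simp [SpinConfig.toReal, h]

theorem SpinConfig.abs_toReal {n : ℕ} (σ : SpinConfig n) (i : Fin n) : |σ.toReal i| = 1 := by
  rcases Int.units_eq_one_or (σ i) with h | h <;> simp [SpinConfig.toReal, h]

/-- The covectors of the Sherrington-Kirkpatrick Hamiltonian. -/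
noncomputable def skCovector (β : ℝ) (n : ℕ) (σ : SpinConfig n) (p : Fin n × Fin n) : ℝ :=
  β * (√(2 * n))⁻¹ * (σ.toReal p.1 * σ.toReal p.2)

/-- The double sum over couplings factors into the square of the overlap, the only feature of the
model that the comparison uses. -/
theorem sum_skCovector_mul (β : ℝ) (n : ℕ) (σ τ : SpinConfig n) :
    ∑ p, skCovector β n σ p * skCovector β n τ p
      = β ^ 2 / 2 * ((∑ i, σ.toReal i * τ.toReal i) ^ 2 / n) := by
  have hs : ((√(2 * n : ℝ))⁻¹) ^ 2 = (2 * (n : ℝ))⁻¹ := by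
    rw [inv_pow, Real.sq_sqrt (by positivity)]
  have h : ∀ p : Fin n × Fin n, skCovector β n σ p * skCovector β n τ p
      = β ^ 2 * ((√(2 * n : ℝ))⁻¹) ^ 2 *
        ((σ.toReal p.1 * τ.toReal p.1) * (σ.toReal p.2 * τ.toReal p.2)) := fun p => by
    unfold skCovector; ring
  simp_rw [h, hs]
  rw [← Finset.mul_sum, Fintype.sum_prod_type]
  simp only
  rw [← Finset.sum_mul_sum, mul_inv]
  ring

theorem sum_skCovector_mul_self (β : ℝ) (n : ℕ) (σ : SpinConfig n) :
    ∑ p, skCovector β n σ p * skCovector β n σ p = β ^ 2 / 2 * n := by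
  rw [sum_skCovector_mul]
  simp only [SpinConfig.toReal_mul_self, Finset.sum_const, Finset.card_univ, Fintype.card_fin,
    nsmul_eq_mul, mul_one]
  rw [sq (n : ℝ), mul_self_div_self]

/-- The mean free energy of the Sherrington-Kirkpatrick model. -/
noncomputable def skMeanFreeEnergy (β : ℝ) (n : ℕ) : ℝ :=
  ∫ x, logSumExp (skCovector β n) x ∂gaussianPi (Fin n × Fin n)

/-- Convexity of the square. The hypotheses cover empty blocks, where division by zero yields 0. -/
theorem add_sq_div_add_le {n m : ℕ} {a b : ℝ} (ha : n = 0 → a = 0) (hb : m = 0 → b = 0) :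
    (a + b) ^ 2 / ((n + m : ℕ) : ℝ) ≤ a ^ 2 / n + b ^ 2 / m := by
  rcases Nat.eq_zero_or_pos n with rfl | hn
  · simp [ha rfl]
  rcases Nat.eq_zero_or_pos m with rfl | hm
  · simp [hb rfl]
  have hn' : (0 : ℝ) < n := by exact_mod_cast hn
  have hm' : (0 : ℝ) < m := by exact_mod_cast hm
  push_cast
  rw [div_add_div _ _ hn'.ne' hm'.ne', div_le_div_iff₀ (by positivity) (by positivity)]
  nlinarith [sq_nonneg (a * m - b * n)]

/-- Without interaction between the blocks the partition function factorises. -/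
theorem logSumExp_sum_elim {S T U ι κ : Type*} [Fintype S] [Fintype T] [Fintype U] [Fintype ι]
    [Fintype κ] [Nonempty T] [Nonempty U] (e : T × U ≃ S) (a : T → ι → ℝ) (b : U → κ → ℝ)
    (c : S → ι ⊕ κ → ℝ) (hc : ∀ σ τ, c (e (σ, τ)) = Sum.elim (a σ) (b τ))
    (x : ι → ℝ) (y : κ → ℝ) :
    logSumExp c (Sum.elim x y) = logSumExp a x + logSumExp b y := by
  unfold logSumExp
  rw [← Real.log_mul (sum_exp_pos a x).ne' (sum_exp_pos b y).ne', Finset.sum_mul_sum,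
    ← Equiv.sum_comp e, Fintype.sum_prod_type]
  simp [hc, Real.exp_add]

/-- Superadditivity of the mean free energy. -/
theorem skMeanFreeEnergy_add_le (β : ℝ) (n m : ℕ) :
    skMeanFreeEnergy β n + skMeanFreeEnergy β m ≤ skMeanFreeEnergy β (n + m) := by
  let e : SpinConfig n × SpinConfig m ≃ SpinConfig (n + m) := Fin.appendEquiv n m
  let b : SpinConfig (n + m) → (Fin n × Fin n) ⊕ (Fin m × Fin m) → ℝ := fun σ =>
    Sum.elim (skCovector β n (e.symm σ).1) (skCovector β m (e.symm σ).2)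
  have hl : ∀ (σ : SpinConfig (n + m)) i,
      (e.symm σ).1.toReal i = σ.toReal (Fin.castAdd m i) := fun σ i => rfl
  have hr : ∀ (σ : SpinConfig (n + m)) i,
      (e.symm σ).2.toReal i = σ.toReal (Fin.natAdd n i) := fun σ i => rfl
  have hb : ∀ σ τ, ∑ i, b σ i * b τ i
      = ∑ p, skCovector β n (e.symm σ).1 p * skCovector β n (e.symm τ).1 p
        + ∑ p, skCovector β m (e.symm σ).2 p * skCovector β m (e.symm τ).2 p := fun σ τ => by
    simp [b, Fintype.sum_sum_type]
  -- The decoupled system `b` has the same variances and the larger covariances, hence the smaller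
  -- mean free energy.
  have key := integral_logSumExp_le_of_covariance_le (a := skCovector β (n + m)) (b := b)
    (fun σ => by
      rw [hb]
      simp only [sum_skCovector_mul_self]
      push_cast
      ring)
    (fun σ τ => by
      rw [hb]
      simp only [sum_skCovector_mul]
      rw [← mul_add]
      refine mul_le_mul_of_nonneg_left ?_ (by positivity)
      rw [Fin.sum_univ_add]
      simp only [hl, hr]
      refine add_sq_div_add_le ?_ ?_
      · rintro rfl; simp
      · rintro rfl; simp)
  refine le_trans (le_of_eq ?_) key
  rw [integral_gaussianPi_sum]
  have hadd : ∀ p : (Fin n × Fin n → ℝ) × (Fin m × Fin m → ℝ),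
      logSumExp b (Sum.elim p.1 p.2)
        = logSumExp (skCovector β n) p.1 + logSumExp (skCovector β m) p.2 := fun p =>
    logSumExp_sum_elim e _ _ b (fun σ τ => by simp [b]) p.1 p.2
  simp_rw [hadd]
  rw [integral_add ((integrable_logSumExp _).comp_fst _) ((integrable_logSumExp _).comp_snd _),
    integral_fun_fst (fun x => logSumExp (skCovector β n) x),
    integral_fun_snd (fun x => logSumExp (skCovector β m) x)]
  simp [skMeanFreeEnergy]

theorem skMeanFreeEnergy_le (β : ℝ) (n : ℕ) :
    skMeanFreeEnergy β n ≤ n * (Real.log 2 + β ^ 2 / 4) := by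
  refine (integral_logSumExp_le (l := β ^ 2 / 2 * n) fun σ => ?_).trans_eq ?_
  · simp_rw [sq]
    rw [sum_skCovector_mul_self, sq]
  · rw [Fintype.card_fun, Fintype.card_fin, Fintype.card_units_int]
    push_cast
    rw [Real.log_pow]
    ring

/-- The mean free energy per spin converges. -/
theorem exists_tendsto_skMeanFreeEnergy_div (β : ℝ) :
    ∃ φ : ℝ, Tendsto (fun n : ℕ => skMeanFreeEnergy β n / n) atTop (𝓝 φ) := by
  have hsub : Subadditive fun n => -skMeanFreeEnergy β n := fun n m => by
    linarith [skMeanFreeEnergy_add_le β n m]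
  refine ⟨-hsub.lim, ?_⟩
  have := (hsub.tendsto_lim ⟨-(Real.log 2 + β ^ 2 / 4), ?_⟩).neg
  · simpa [neg_div] using this
  · rintro _ ⟨n, rfl⟩
    rcases Nat.eq_zero_or_pos n with rfl | hn
    -- The lower bound must also hold at n = 0, where the quotient is 0 by convention.
    · have : 0 ≤ Real.log 2 := Real.log_nonneg (by norm_num)
      simp only [Nat.cast_zero, div_zero]
      have := sq_nonneg β
      linarith
    · have hn' : (0 : ℝ) < n := by exact_mod_cast hn
      rw [le_div_iff₀ hn']
      linarith [skMeanFreeEnergy_le β n]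

/-! ### From GOE matrices to independent Gaussian entries -/

theorem measurePreserving_uncurry_gaussianMatrix (n : ℕ) :
    MeasurePreserving (fun (G : Matrix (Fin n) (Fin n) ℝ) (p : Fin n × Fin n) => G p.1 p.2)
      (gaussianMatrix n) (gaussianPi (Fin n × Fin n)) := by
  have hm : Measurable fun (G : Matrix (Fin n) (Fin n) ℝ) (p : Fin n × Fin n) => G p.1 p.2 :=
    measurable_pi_lambda _ fun p => (measurable_pi_apply p.2).comp (measurable_pi_apply p.1)
  refine ⟨hm, (Measure.pi_eq fun s hs => ?_).symm⟩
  rw [Measure.map_apply hm (MeasurableSet.univ_pi hs)]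
  have : (fun (G : Matrix (Fin n) (Fin n) ℝ) (p : Fin n × Fin n) => G p.1 p.2) ⁻¹' Set.univ.pi s
      = Set.univ.pi fun i => Set.univ.pi fun j => s (i, j) := by
    ext G
    exact ⟨fun h i _ j _ => h (i, j) trivial, fun h p _ => h p.1 trivial p.2 trivial⟩
  rw [this, Fintype.prod_prod_type]
  refine (Measure.pi_pi (fun _ : Fin n => gaussianPi (Fin n)) _).trans ?_
  exact Finset.prod_congr rfl fun i _ => Measure.pi_pi _ _

/-- With no signal term `x₀` drops out, so it may depend on the sample point in any way, measurably
or not. -/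
theorem partitionFunction_zero_snr_eq {n : ℕ} (β : ℝ) (x₀ : SpinConfig n)
    (W : Matrix (Fin n) (Fin n) ℝ) : partitionFunction β 0 x₀ W = partitionFunction β 0 1 W := by
  simp [partitionFunction]

/-- The quadratic form does not distinguish G from its transpose, so the factor 1/2 cancels and the
dependent entries of W give way to the n² independent entries of G. -/
theorem log_partitionFunction_symmetrize {n : ℕ} (β : ℝ) (x₀ : SpinConfig n)
    (G : Matrix (Fin n) (Fin n) ℝ) :
    Real.log (partitionFunction β 0 x₀ ((√(2 * n))⁻¹ • (G + G.transpose)))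
      = logSumExp (skCovector β n) fun p => G p.1 p.2 := by
  unfold partitionFunction logSumExp
  congr 1
  refine Finset.sum_congr rfl fun σ _ => ?_
  congr 1
  simp only [mul_zero, zero_div, zero_mul, zero_add, Matrix.smul_apply, Matrix.add_apply,
    Matrix.transpose_apply, smul_eq_mul]
  rw [Fintype.sum_prod_type]
  simp only [skCovector]
  have h : ∑ i, ∑ j, G j i * (σ.toReal i * σ.toReal j)
      = ∑ i, ∑ j, G i j * (σ.toReal i * σ.toReal j) := by
    rw [Finset.sum_comm]
    exact Finset.sum_congr rfl fun i _ => Finset.sum_congr rfl fun j _ => by ring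
  have h1 : ∑ i, ∑ j, (√(2 * n : ℝ))⁻¹ * (G i j + G j i) * (σ.toReal i * σ.toReal j)
      = (√(2 * n : ℝ))⁻¹ * (∑ i, ∑ j, G i j * (σ.toReal i * σ.toReal j)
        + ∑ i, ∑ j, G j i * (σ.toReal i * σ.toReal j)) := by
    simp_rw [← Finset.sum_add_distrib, Finset.mul_sum]
    exact Finset.sum_congr rfl fun i _ => Finset.sum_congr rfl fun j _ => by ring
  have h2 : ∑ i, ∑ j, β * (√(2 * n : ℝ))⁻¹ * (σ.toReal i * σ.toReal j) * G i j
      = β * (√(2 * n : ℝ))⁻¹ * ∑ i, ∑ j, G i j * (σ.toReal i * σ.toReal j) := by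
    simp_rw [Finset.mul_sum]
    exact Finset.sum_congr rfl fun i _ => Finset.sum_congr rfl fun j _ => by ring
  rw [h1, h2, h]
  ring

theorem measurable_partitionFunction {n : ℕ} (β lam : ℝ) (x₀ : SpinConfig n) :
    Measurable fun W : Matrix (Fin n) (Fin n) ℝ => partitionFunction β lam x₀ W := by
  have h : ∀ i j, Measurable fun W : Matrix (Fin n) (Fin n) ℝ => W i j := fun i j =>
    (measurable_pi_apply j).comp (measurable_pi_apply i)
  unfold partitionFunction
  fun_prop

theorem measurable_symmetrize (n : ℕ) : Measurable fun G : Matrix (Fin n) (Fin n) ℝ =>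
    (√(2 * n : ℝ))⁻¹ • (G + G.transpose) := by
  have h : ∀ i j, Measurable fun W : Matrix (Fin n) (Fin n) ℝ => W i j := fun i j =>
    (measurable_pi_apply j).comp (measurable_pi_apply i)
  refine measurable_pi_lambda _ fun i => measurable_pi_lambda _ fun j => ?_
  exact ((h i j).add (h j i)).const_mul _

/-- Exponential concentration of the free energy around its mean. -/
theorem GOE_abs_log_partitionFunction_sub_ge_le {β : ℝ} (hβ : 0 < β) (n : ℕ) {t : ℝ}
    (ht : 0 ≤ t) :
    (GOE n) {W | t * n ≤ |Real.log (partitionFunction β 0 1 W) - skMeanFreeEnergy β n|}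
      ≤ ENNReal.ofReal (2 * Real.exp (n * (-t ^ 2 / (2 * β ^ 2)))) := by
  have hms : MeasurableSet {W : Matrix (Fin n) (Fin n) ℝ |
      t * n ≤ |Real.log (partitionFunction β 0 1 W) - skMeanFreeEnergy β n|} := by
    have := measurable_partitionFunction β 0 (1 : SpinConfig n)
    exact measurableSet_le measurable_const (by fun_prop)
  have hlip : L1Lipschitz (β * (√(2 * n : ℝ))⁻¹) (logSumExp (skCovector β n)) :=
    l1Lipschitz_logSumExp fun σ p => by
      rw [skCovector, abs_mul, abs_mul (σ.toReal _), SpinConfig.abs_toReal, SpinConfig.abs_toReal,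
        abs_of_nonneg (by positivity)]
      simp
  have hmp := measurePreserving_uncurry_gaussianMatrix n
  have hms' : MeasurableSet {x | t * n ≤ |logSumExp (skCovector β n) x - skMeanFreeEnergy β n|} :=
    measurableSet_le measurable_const
      ((hlip.continuous.measurable.sub_const _).abs)
  rw [GOE, Measure.map_apply (measurable_symmetrize n) hms, Set.preimage_ofPred_eq]
  simp_rw [log_partitionFunction_symmetrize]
  have h := hmp.measure_preimage hms'.nullMeasurableSet
  rw [Set.preimage_ofPred_eq] at h
  rw [h, ← ENNReal.ofReal_toReal (measure_ne_top _ _)]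
  -- With n² coordinates and l² = β²/(2n), the exponent is n(-st + s²β²/2), minimised at s = t/β².
  refine ENNReal.ofReal_le_ofReal ((hlip.measure_abs_ge_le (by positivity)
    (s := t / β ^ 2) (t := t * n) (by positivity)).trans_eq ?_)
  rw [mul_pow, inv_pow, Real.sq_sqrt (by positivity), Fintype.card_prod, Fintype.card_fin]
  congr 2
  rcases Nat.eq_zero_or_pos n with rfl | hn
  · simp
  push_cast
  field_simp
  ring

end SherringtonKirkpatrick

/-! ### Almost sure convergence -/

theorem mainTheorem2 (β : ℝ) (hβ : 0 < β) :
    ∃ φ : ℝ, ∀ (Ω : Type*) [MeasurableSpace Ω] (P : Measure Ω) [IsProbabilityMeasure P]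
      (W : (n : ℕ) → Ω → Matrix (Fin n) (Fin n) ℝ) (_hW : ∀ n, HasLaw (W n) (GOE n) P)
      (x₀ : (n : ℕ) → Ω → SpinConfig n),
      ∀ᵐ ω ∂P, Tendsto
        (fun n : ℕ => (n : ℝ)⁻¹ * Real.log (partitionFunction β 0 (x₀ n ω) (W n ω)))
        atTop (𝓝 φ) := by
  obtain ⟨φ, hφ⟩ := exists_tendsto_skMeanFreeEnergy_div β
  refine ⟨φ, fun Ω _ P _ W hW x₀ => ?_⟩
  -- Thresholds 1/(k+1) keep the family countable, so the exceptional null sets can be united.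
  have hconc : ∀ k : ℕ, ∀ᵐ ω ∂P, ∀ᶠ n : ℕ in atTop,
      |Real.log (partitionFunction β 0 1 (W n ω)) - skMeanFreeEnergy β n| < (k + 1 : ℝ)⁻¹ * n := by
    intro k
    have ht : (0 : ℝ) < (k + 1 : ℝ)⁻¹ := by positivity
    have hle : ∀ n, P {ω | (k + 1 : ℝ)⁻¹ * n ≤
        |Real.log (partitionFunction β 0 1 (W n ω)) - skMeanFreeEnergy β n|}
        ≤ ENNReal.ofReal (2 * Real.exp (n * (-((k + 1 : ℝ)⁻¹) ^ 2 / (2 * β ^ 2)))) := fun n => by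
      have h := GOE_abs_log_partitionFunction_sub_ge_le hβ n ht.le
      rw [← (hW n).map_eq] at h
      -- Only this inequality is needed, and it requires no measurability of the event.
      exact (Measure.le_map_apply (hW n).aemeasurable _).trans h
    have hsum : Summable fun n : ℕ =>
        2 * Real.exp (n * (-((k + 1 : ℝ)⁻¹) ^ 2 / (2 * β ^ 2))) := by
      refine (Real.summable_exp_nat_mul_iff.2 ?_).mul_left 2
      have : 0 < ((k + 1 : ℝ)⁻¹) ^ 2 / (2 * β ^ 2) := by positivity
      rw [neg_div]
      linarith
    have hfin : ∑' n, P {ω | (k + 1 : ℝ)⁻¹ * n ≤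
        |Real.log (partitionFunction β 0 1 (W n ω)) - skMeanFreeEnergy β n|} ≠ ⊤ := by
      refine ne_top_of_le_ne_top ?_ (ENNReal.tsum_le_tsum hle)
      rw [← ENNReal.ofReal_tsum_of_nonneg (fun n => by positivity) hsum]
      exact ENNReal.ofReal_ne_top
    filter_upwards [ae_eventually_notMem hfin] with ω hω
    filter_upwards [hω] with n hn
    exact not_le.1 hn
  filter_upwards [ae_all_iff.2 hconc] with ω hω
  have hdiff : Tendsto (fun n : ℕ => (n : ℝ)⁻¹ * Real.log (partitionFunction β 0 1 (W n ω))
      - skMeanFreeEnergy β n / n) atTop (𝓝 0) := by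
    -- The primed form gives n > N, hence n > 0, which the division by n needs.
    rw [Metric.tendsto_atTop']
    intro ε hε
    obtain ⟨k, hk⟩ := exists_nat_one_div_lt hε
    obtain ⟨N, hN⟩ := eventually_atTop.1 (hω k)
    refine ⟨N, fun n hn => ?_⟩
    have hn0 : (0 : ℝ) < n := by exact_mod_cast (Nat.zero_le N).trans_lt hn
    rw [Real.dist_eq, sub_zero, div_eq_inv_mul, ← mul_sub, abs_mul, abs_of_pos (inv_pos.2 hn0),
      inv_mul_lt_iff₀ hn0]
    rw [one_div] at hk
    calc _ < (k + 1 : ℝ)⁻¹ * n := hN n hn.le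
      _ ≤ n * ε := by rw [mul_comm]; exact mul_le_mul_of_nonneg_left hk.le hn0.le
  have := hdiff.add hφ
  rw [zero_add] at this
  refine this.congr fun n => ?_
  rw [partitionFunction_zero_snr_eq β (x₀ n ω)]
  ring
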